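/- Conventions. All Hilbert spaces are finite-dimensional and $\log$ is binary. For $\mathcal H$ let $\mathcal S_{=}(\mathcal H)$ (resp. $\mathcal S_{\le}(\mathcal H)$) be the set of positive semi-definite operators $\rho$ with $\operatorname{tr}\rho=1$ (resp. $0<\operatorname{tr}\rho\le 1$), and let $\|M\|_1=\operatorname{tr}|M|$. The purified distance on $\mathcal S_{\le}(\mathcal H)$ is $P(\rho,\tau)=\sqrt{1-\bar F(\rho,\tau)^2}$ with $\bar F(\rho,\tau)=\operatorname{tr}|\sqrt\rho\sqrt\tau|+\sqrt{(1-\operatorname{tr}\rho)(1-\operatorname{tr}\tau)}$. For $\rho_{AB}\in\mathcal S_{\le}(\mathcal H_A\otimes\mathcal H_B)$ and $\varepsilon\ge 0$, $$H_{\min}(A|B)_\rho=\sup_{\sigma_B\in\mathcal S_{=}(\mathcal H_B)}\sup\{\lambda\in\mathbb R:\rho_{AB}\le 2^{-\lambda}\,1_A\otimes\sigma_B\},\qquad H_{\min}^{\varepsilon}(A|B)_\rho=\sup_{\tilde\rho\in\mathcal S_{\le},\ P(\rho,\tilde\rho)\le\varepsilon}H_{\min}(A|B)_{\tilde\rho}\in(-\infty,+\infty],$$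 and the distance from uniform is $d_u(A|B)_\rho=\min_{\sigma_B}\tfrac12\|\rho_{AB}-\omega_A\otimes\sigma_B\|_1$, where $\omega_A=1_A/\dim\mathcal H_A$ and $\sigma_B$ ranges over the positive semi-definite operators with $\operatorname{tr}\sigma_B=\operatorname{tr}\rho_{B}$. Let $\mathcal F=\{f_\alpha\}_{\alpha\in S}$ be a family of functions from $\{0,1\}^n$ to $\{0,1\}^\ell$ with a finite non-empty index set $S$. Its seed length is $s=\log|S|$. For a classical-quantum state $\rho_{XE}=\sum_{x\in\{0,1\}^n}|x\rangle\langle x|\otimes\rho_E^{[x]}\in\mathcal S_{\le}$, its error is $e=d_u(Z|FE)_\rho$, evaluated for the state after hashing with a uniformly random member whose index is published, $$\rho_{FZE}=\sum_{\alpha\in S}\sum_{z\in\{0,1\}^\ell}\frac1{|S|}\,|\alpha\rangle\langle \alpha|\otimes|z\rangle\langle z|\otimes\sum_{x:\,f_\alpha(x)=z}\rho_E^{[x]}.$$ Theorem. For all $n,\ell\ge 0$ there is a family of functions from $\{0,1\}^n$ to $\{0,1\}^\ell$ with seed length $s=n$ such that, for every quantum system $E$, every classical-quantum state $\rho_{XE}$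 as above and every $\varepsilon\ge0$, $$e\le\varepsilon+\tfrac12\sqrt{2^{\ell-H_{\min}^{\varepsilon}(X|E)_\rho}}$$ (with $2^{-\infty}=0$). Moreover, if $n\ge1$ and $\ell\le n$, then the family $f_\alpha(x)=x\cdot\alpha\bmod 2^\ell$, $\alpha\in\{0,1\}^n$, has this property. Here $x\cdot\alpha$ is the product in $\mathrm{GF}(2^n)$, whose elements are identified with $\{0,1\}^n$ by any $\mathbb F_2$-linear bijection, and $\bmod\ 2^\ell$ keeps the $\ell$ least significant bits. -/

import Mathlib

open scoped Kronecker MatrixOrder ComplexOrder ENNReal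
open Matrix

universe u

namespace LeftoverHash

noncomputable section

/-! States of finite-dimensional quantum systems are complex matrices indexed by an orthonormal
basis; a bipartite system `AB` has the index type `A × B`, and `⊗ₖ` is the tensor product. -/

/-- The trace norm `‖M‖₁ = tr |M|`, where `|M| = √(Mᴴ M)`. -/
def traceNorm {ι : Type*} [Fintype ι] [DecidableEq ι] (M : Matrix ι ι ℂ) : ℝ :=
  (CFC.sqrt (Mᴴ * M)).trace.re

/-- Normalized states: positive semi-definite of trace one. -/
def IsNormalized {ι : Type*} [Fintype ι] (ρ : Matrix ι ι ℂ) : Prop :=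
  ρ.PosSemidef ∧ ρ.trace = 1

/-- Sub-normalized states: positive semi-definite with `0 < tr ρ ≤ 1`. -/
def IsSubnormalized {ι : Type*} [Fintype ι] (ρ : Matrix ι ι ℂ) : Prop :=
  ρ.PosSemidef ∧ 0 < ρ.trace.re ∧ ρ.trace.re ≤ 1

/-- The generalized fidelity `tr |√ρ √τ| + √((1 - tr ρ) (1 - tr τ))`. -/
def genFidelity {ι : Type*} [Fintype ι] [DecidableEq ι] (ρ τ : Matrix ι ι ℂ) : ℝ :=
  traceNorm (CFC.sqrt ρ * CFC.sqrt τ) + √((1 - ρ.trace.re) * (1 - τ.trace.re))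

/-- The purified distance. -/
def purifiedDist {ι : Type*} [Fintype ι] [DecidableEq ι] (ρ τ : Matrix ι ι ℂ) : ℝ :=
  √(1 - genFidelity ρ τ ^ 2)

/-- The `ε`-ball of sub-normalized states around `ρ` in purified distance. -/
def epsBall {ι : Type*} [Fintype ι] [DecidableEq ι] (ε : ℝ) (ρ : Matrix ι ι ℂ) :
    Set (Matrix ι ι ℂ) :=
  {τ | IsSubnormalized τ ∧ purifiedDist ρ τ ≤ ε}

/-- The min-entropy `H_min(A|B)_ρ` of `A` conditioned on `B`: the supremum, over all normalized
states `σ` on `B`, of `sup {lam : ℝ | ρ ≤ 2 ^ (-lam) • (1 ⊗ σ)}`, with `sup ∅ = -∞`. -/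
def minEntropy {A B : Type*} [Fintype A] [DecidableEq A] [Fintype B]
    (ρ : Matrix (A × B) (A × B) ℂ) : EReal :=
  ⨆ σ ∈ {σ : Matrix B B ℂ | IsNormalized σ},
    ⨆ lam ∈ {lam : ℝ | ρ ≤ ((2 : ℝ) ^ (-lam)) • ((1 : Matrix A A ℂ) ⊗ₖ σ)}, (lam : EReal)

/-- The smooth min-entropy: the supremum of the min-entropy over the `ε`-ball. It is `+∞` when `ε`
is so large that the ball contains states of arbitrarily small trace. -/
def smoothMinEntropy {A B : Type*} [Fintype A] [DecidableEq A] [Fintype B] [DecidableEq B]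
    (ε : ℝ) (ρ : Matrix (A × B) (A × B) ℂ) : EReal :=
  ⨆ τ ∈ epsBall ε ρ, minEntropy τ

/-- The distance from uniform `d_u(A|B)_ρ`: the minimum of `‖ρ - ω ⊗ σ‖₁ / 2` over all positive
semi-definite `σ` on `B` with `tr σ = tr ρ` (which is the trace of the marginal of `ρ` on `B`),
where `ω = 1 / dim A` is maximally mixed. -/
def distFromUniform {A B : Type*} [Fintype A] [DecidableEq A] [Fintype B] [DecidableEq B]
    (ρ : Matrix (A × B) (A × B) ℂ) : ℝ :=
  sInf ((fun σ : Matrix B B ℂ =>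
      1 / 2 * traceNorm (ρ - ((Fintype.card A : ℂ)⁻¹ • (1 : Matrix A A ℂ)) ⊗ₖ σ)) ''
    {σ | σ.PosSemidef ∧ σ.trace = ρ.trace})

/-- The classical-quantum state `∑ₓ |x⟩⟨x| ⊗ ρ^[x]`. -/
def cqState {X E : Type*} [Fintype X] [DecidableEq X] (ρ : X → Matrix E E ℂ) :
    Matrix (X × E) (X × E) ℂ :=
  ∑ x, Matrix.single x x (1 : ℂ) ⊗ₖ ρ x

/-- The state `∑_f ∑_z p_f |z⟩⟨z| ⊗ (|f⟩⟨f| ⊗ ρ^[f,z])` after hashing with a uniformly random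
member `F f` of the family, where `p_f = 1 / |S|` and `ρ^[f,z] = ∑_{x, F f x = z} ρ^[x]`.
The seed `f : S` is published; the factors are ordered as output `Z`, then side information
`(F, E)`. -/
def hashedState {S X Z E : Type*} [Fintype S] [DecidableEq S] [Fintype X]
    [Fintype Z] [DecidableEq Z] (F : S → X → Z) (ρ : X → Matrix E E ℂ) :
    Matrix (Z × (S × E)) (Z × (S × E)) ℂ :=
  ∑ f, ∑ z, (Fintype.card S : ℂ)⁻¹ •
    (Matrix.single z z (1 : ℂ) ⊗ₖ
      (Matrix.single f f (1 : ℂ) ⊗ₖ ∑ x with F f x = z, ρ x))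

/-- The error `e = d_u(Z|FE)` of randomness extraction with the hash family `F`. -/
def extractionError {S X Z E : Type*} [Fintype S] [DecidableEq S] [Fintype X]
    [Fintype Z] [DecidableEq Z] [Fintype E] [DecidableEq E]
    (F : S → X → Z) (ρ : X → Matrix E E ℂ) : ℝ :=
  distFromUniform (hashedState F ρ)

/-- The seed length `s = log₂ |S|` of a family of functions indexed by `S`. -/
def seedLength {S X Z : Type*} [Fintype S] (_F : S → X → Z) : ℝ :=
  Real.logb 2 (Fintype.card S)

/-- `2 ^ x` for an extended real `x`. -/
def twoPow (x : EReal) : ℝ≥0∞ :=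
  if x = ⊥ then 0 else if x = ⊤ then ⊤ else (2 : ℝ≥0∞) ^ x.toReal

/-- Bit strings of length `n`, the bit at position `0` being the least significant one. -/
abbrev Bits (n : ℕ) : Type := Fin n → ZMod 2

/-- The family `f_α(x) = x · α mod 2 ^ ℓ`: multiplication in `GF(2^n)`, the elements of which are
identified with bit strings by an additive bijection `φ`, followed by truncation to `ℓ` bits. -/
def multHash {n ℓ : ℕ} (hℓ : ℓ ≤ n) (φ : GaloisField 2 n ≃ₗ[ZMod 2] Bits n) :
    Bits n → Bits n → Bits ℓ :=
  fun α x i => φ (φ.symm x * φ.symm α) (Fin.castLE hℓ i)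

/-- For every finite-dimensional quantum system `E`, every classical-quantum state on `XE` and
every `ε ≥ 0`, extraction with the family `F` of functions to `ℓ`-bit strings has an error of at
most `ε + √(2 ^ (ℓ - H_min^ε(X|E))) / 2`. -/
def SatisfiesErrorBound {S X : Type} {ℓ : ℕ} [Fintype S] [DecidableEq S] [Fintype X]
    [DecidableEq X] (F : S → X → Bits ℓ) : Prop :=
  ∀ (E : Type u) [Fintype E] [DecidableEq E] (ρ : X → Matrix E E ℂ),
    IsSubnormalized (cqState ρ) → ∀ ε : ℝ, 0 ≤ ε →
      ENNReal.ofReal (extractionError F ρ) ≤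
        ENNReal.ofReal ε +
          1 / 2 * twoPow ((ℓ : EReal) - smoothMinEntropy ε (cqState ρ)) ^ (1 / 2 : ℝ)

end

end LeftoverHash

/-! Let `τ` be a state in the `ε`-ball with `τ ≤ 2 ^ (-lam) (1 ⊗ σ)`. It need not be classical on
`X`, but only its diagonal blocks `τ_x ≤ 2 ^ (-lam) σ` matter: measuring `X` and hashing does not
increase the trace norm (`traceNorm_hashedState_diagBlock_le`). Hence the error for `ρ` exceeds the
one for `τ` by at most `‖ρ - τ‖₁ / 2 + |tr ρ - tr τ| / 2`, where the second term pays for rescaling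
the reference state on `FE` (`two_mul_extractionError_le`). By the Fuchs–van de Graaf inequality for
sub-normalized states this is at most the purified distance, hence at most `ε`
(`traceNorm_sub_add_le_purifiedDist`).

For `τ` itself, put `Δ_{f,z} = ∑ₓ ([f(x) = z] - 2 ^ (-ℓ)) τ_x`, and let `K` be a contraction. Young's
inequality weighted by `σ` (first for invertible `σ`, then in the limit) bounds `2 Re tr (K Δ)` by
`t tr σ + tr (Δ σ⁻¹ Δ) / t`. The average of `∑_z tr (Δ σ⁻¹ Δ)` over the family involves only the
collision probabilities of pairs `x ≠ y`. The form `tr (τ_x σ⁻¹ τ_y)` can be negative for `x ≠ y`, so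
a mere upper bound on these probabilities would not do here; it suffices that they all equal one
`δ ≤ 2 ^ (-ℓ)`, as the cross terms then add up to a nonpositive multiple of
`tr (τ_E σ⁻¹ τ_E)` (`sum_re_trace_deviation_le`). The remaining diagonal terms satisfy
`tr (τ_x σ⁻¹ τ_x) ≤ 2 ^ (-lam) tr τ_x`, and optimizing `t` gives
`√(2 ^ (ℓ - lam))` as a bound on the trace norm of the block diagonal operator formed by the
`Δ_{f,z} / |S|` (`traceNorm_seedAverage_deviation_le`).

Multiplication in `GF(2 ^ n)` followed by truncation has `δ = 2 ^ (-ℓ)`; for `n ≤ ℓ`, the constant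
family consisting of an injection has `δ = 0`.

Trace norms are handled throughout by duality: `‖M‖₁` is the maximum of `Re tr (K M)` over
contractions `K`, and is attained by the adjoint of the partial isometry in the polar
decomposition. -/

open scoped Kronecker MatrixOrder ComplexOrder ENNReal
open Matrix

namespace LeftoverHash

noncomputable section

/-! ### The trace norm and its dual characterization -/

section TraceNorm

lemma re_trace_nonneg {ι : Type*} [Fintype ι] {M : Matrix ι ι ℂ} (hM : M.PosSemidef) :
    0 ≤ M.trace.re :=
  (Complex.le_def.1 hM.trace_nonneg).1

lemma re_trace_mul_conjTranspose_nonneg {ι : Type*} [Fintype ι] (M : Matrix ι ι ℂ) :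
    0 ≤ (M * Mᴴ).trace.re :=
  re_trace_nonneg (posSemidef_self_mul_conjTranspose M)

lemma re_trace_conjTranspose {ι : Type*} [Fintype ι] (M : Matrix ι ι ℂ) :
    Mᴴ.trace.re = M.trace.re := by
  rw [trace_conjTranspose]; simp

variable {ι : Type*} [Fintype ι] [DecidableEq ι]

/-- A positive semi-definite matrix has a Moore–Penrose inverse commuting with it. -/
lemma exists_pseudoInverse {A : Matrix ι ι ℂ} (hA : A.PosSemidef) :
    ∃ B : Matrix ι ι ℂ, Bᴴ = B ∧ A * B * A = A ∧ B * A * B = B ∧ A * B = B * A := by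
  have hs : IsSelfAdjoint A := hA.1
  have hc (f : ℝ → ℝ) : ContinuousOn f (spectrum ℝ A) :=
    (Matrix.finite_real_spectrum (A := A)).continuousOn f
  have hid : cfc (fun x : ℝ => x) A = A := cfc_id' ℝ A
  refine ⟨cfc (fun x : ℝ => x⁻¹) A, ?_, ?_, ?_, ?_⟩
  · exact (cfc_predicate (fun x : ℝ => x⁻¹) A : IsSelfAdjoint _)
  · have h : cfc (fun x : ℝ => x * x⁻¹ * x) A = A := by
      simp only [mul_inv_mul_cancel, hid]
    rw [cfc_mul _ _ _ (hc _) (hc _), cfc_mul _ _ _ (hc _) (hc _), hid] at h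
    exact h
  · have h : cfc (fun x : ℝ => x⁻¹ * x * x⁻¹) A = cfc (fun x : ℝ => x⁻¹) A := by
      congr 1; funext x; simpa using mul_inv_mul_cancel x⁻¹
    rw [cfc_mul _ _ _ (hc _) (hc _), cfc_mul _ _ _ (hc _) (hc _), hid] at h
    exact h
  · have h : cfc (fun x : ℝ => x * x⁻¹) A = cfc (fun x : ℝ => x⁻¹ * x) A := by
      simp only [mul_comm]
    rw [cfc_mul _ _ _ (hc _) (hc _), cfc_mul _ _ _ (hc _) (hc _), hid] at h
    exact h

lemma posSemidef_sqrt (M : Matrix ι ι ℂ) : (CFC.sqrt M).PosSemidef :=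
  Matrix.nonneg_iff_posSemidef.1 (CFC.sqrt_nonneg M)

lemma sqrt_mul_sqrt {M : Matrix ι ι ℂ} (hM : M.PosSemidef) : CFC.sqrt M * CFC.sqrt M = M :=
  CFC.sqrt_mul_sqrt_self M (Matrix.nonneg_iff_posSemidef.2 hM)

/-- Polar decomposition: `Cᴴ` is a partial isometry with `M = Cᴴ |M|`. -/
lemma exists_polar (M : Matrix ι ι ℂ) :
    ∃ C : Matrix ι ι ℂ, C * M = CFC.sqrt (Mᴴ * M) ∧ Cᴴ * CFC.sqrt (Mᴴ * M) = M ∧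
      C * Cᴴ * C = C := by
  have hA := posSemidef_sqrt (Mᴴ * M)
  have hAA := sqrt_mul_sqrt (posSemidef_conjTranspose_mul_self M)
  set A := CFC.sqrt (Mᴴ * M)
  obtain ⟨B, hB, hABA, hBAB, hcomm⟩ := exists_pseudoInverse hA
  have hAh : Aᴴ = A := hA.1
  have h1 : B * (A * A) = A := by rw [← mul_assoc, ← hcomm, hABA]
  refine ⟨B * Mᴴ, ?_, ?_, ?_⟩
  · rw [mul_assoc, ← hAA, h1]
  · -- The defect `M (1 - B A)` vanishes because its Gram matrix `(1 - A B) A² (1 - B A)` does.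
    have h0 : (M * (1 - B * A))ᴴ * (M * (1 - B * A)) = 0 := by
      have : (M * (1 - B * A))ᴴ * (M * (1 - B * A))
          = (1 - A * B) * ((Mᴴ * M) * (1 - B * A)) := by
        simp only [conjTranspose_mul, conjTranspose_sub, conjTranspose_one, hB, hAh, mul_assoc]
      rw [this, ← hAA]
      have : A * A * (1 - B * A) = 0 := by
        rw [mul_sub, mul_one, mul_assoc, ← mul_assoc A B A, hABA, sub_self]
      rw [this, mul_zero]
    have h2 := conjTranspose_mul_self_eq_zero.1 h0
    rw [mul_sub, mul_one, sub_eq_zero] at h2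
    rw [conjTranspose_mul, conjTranspose_conjTranspose, hB, mul_assoc, ← h2]
  · rw [conjTranspose_mul, conjTranspose_conjTranspose, hB]
    calc B * Mᴴ * (M * B) * (B * Mᴴ) = B * (Mᴴ * M) * B * B * Mᴴ := by simp only [mul_assoc]
      _ = B * Mᴴ := by rw [← hAA, h1, hcomm, hBAB]

/-- Matrices of operator norm at most one. -/
def IsContraction (K : Matrix ι ι ℂ) : Prop := (1 - Kᴴ * K).PosSemidef

lemma IsContraction.neg {K : Matrix ι ι ℂ} (hK : IsContraction K) : IsContraction (-K) := by
  simpa [IsContraction] using hK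

lemma isContraction_of_partialIsometry {C : Matrix ι ι ℂ} (hC : C * Cᴴ * C = C) :
    IsContraction C := by
  have h : 1 - Cᴴ * C = (1 - Cᴴ * C)ᴴ * (1 - Cᴴ * C) := by
    have : Cᴴ * C * (Cᴴ * C) = Cᴴ * C := by rw [mul_assoc, ← mul_assoc C, hC]
    simp only [conjTranspose_sub, conjTranspose_one, conjTranspose_mul,
      conjTranspose_conjTranspose, sub_mul, mul_sub, one_mul, mul_one, this]
    abel
  rw [IsContraction, h]
  exact posSemidef_conjTranspose_mul_self _

lemma IsContraction.re_trace_conj_le {K σ : Matrix ι ι ℂ} (hK : IsContraction K)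
    (hσ : σ.PosSemidef) : (K * σ * Kᴴ).trace.re ≤ σ.trace.re := by
  have h := re_trace_nonneg (hK.conjTranspose_mul_mul_same (CFC.sqrt σ))
  rw [show (CFC.sqrt σ)ᴴ = CFC.sqrt σ from (posSemidef_sqrt σ).1, trace_mul_comm, ← mul_assoc,
    sqrt_mul_sqrt hσ, mul_sub, mul_one, trace_sub, Complex.sub_re,
    show (σ * (Kᴴ * K)).trace = (K * σ * Kᴴ).trace by rw [← mul_assoc, trace_mul_cycle]] at h
  linarith

/-- Young's inequality for the Hilbert–Schmidt inner product, with a contraction inserted. -/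
lemma IsContraction.two_mul_re_trace_le {K : Matrix ι ι ℂ} (hK : IsContraction K)
    (X Y : Matrix ι ι ℂ) {t : ℝ} (ht : 0 < t) :
    2 * (K * (X * Yᴴ)).trace.re ≤ t * (X * Xᴴ).trace.re + t⁻¹ * (Y * Yᴴ).trace.re := by
  have h1 := hK.re_trace_conj_le (posSemidef_self_mul_conjTranspose X)
  have h2 := re_trace_mul_conjTranspose_nonneg ((t : ℂ) • (K * X) - Y)
  have h3 : ((t : ℂ) • (K * X) - Y) * ((t : ℂ) • (K * X) - Y)ᴴ =
      ((t ^ 2 : ℝ) : ℂ) • (K * (X * Xᴴ) * Kᴴ) - (t : ℂ) • (K * (X * Yᴴ))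
        - (t : ℂ) • (K * (X * Yᴴ))ᴴ + Y * Yᴴ := by
    simp only [conjTranspose_sub, conjTranspose_smul, conjTranspose_mul, sub_mul, mul_sub,
      conjTranspose_conjTranspose, mul_assoc, smul_mul_assoc, mul_smul_comm, Complex.star_def,
      Complex.conj_ofReal, Complex.ofReal_pow]
    module
  rw [h3] at h2
  simp only [trace_add, trace_sub, trace_smul, Complex.add_re, Complex.sub_re, smul_eq_mul,
    Complex.re_ofReal_mul, re_trace_conjTranspose] at h2
  have h4 : t * (2 * (K * (X * Yᴴ)).trace.re) ≤
      t * (t * (X * Xᴴ).trace.re + t⁻¹ * (Y * Yᴴ).trace.re) := by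
    rw [mul_add, ← mul_assoc t t⁻¹, mul_inv_cancel₀ ht.ne']
    nlinarith [mul_le_mul_of_nonneg_left h1 (sq_nonneg t)]
  exact le_of_mul_le_mul_left h4 ht

lemma IsContraction.re_trace_mul_le_traceNorm {K : Matrix ι ι ℂ} (hK : IsContraction K)
    (M : Matrix ι ι ℂ) : (K * M).trace.re ≤ traceNorm M := by
  obtain ⟨C, h1, h2, -⟩ := exists_polar M
  have hD := posSemidef_sqrt (CFC.sqrt (Mᴴ * M))
  have hDD := sqrt_mul_sqrt (posSemidef_sqrt (Mᴴ * M))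
  set A := CFC.sqrt (Mᴴ * M) with hA
  set D := CFC.sqrt A
  have hDh : Dᴴ = D := hD.1
  have h := hK.two_mul_re_trace_le (Cᴴ * D) D one_pos
  rw [conjTranspose_mul, hDh, conjTranspose_conjTranspose, mul_assoc Cᴴ, hDD, h2,
    mul_assoc Cᴴ, ← mul_assoc D, hDD, ← mul_assoc, h2, trace_mul_comm M C, h1] at h
  have : traceNorm M = A.trace.re := rfl
  linarith

lemma exists_isContraction_re_trace_eq (M : Matrix ι ι ℂ) :
    ∃ K, IsContraction K ∧ (K * M).trace.re = traceNorm M := by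
  obtain ⟨C, h1, -, h3⟩ := exists_polar M
  exact ⟨C, isContraction_of_partialIsometry h3, by rw [h1]; rfl⟩

/-- The dual characterization of the trace norm, as an upper bound. -/
lemma traceNorm_le {M : Matrix ι ι ℂ} {r : ℝ}
    (h : ∀ K, IsContraction K → (K * M).trace.re ≤ r) : traceNorm M ≤ r := by
  obtain ⟨K, hK, h'⟩ := exists_isContraction_re_trace_eq M
  exact h' ▸ h K hK

lemma traceNorm_nonneg (M : Matrix ι ι ℂ) : 0 ≤ traceNorm M :=
  re_trace_nonneg (posSemidef_sqrt _)

lemma traceNorm_add_le (M N : Matrix ι ι ℂ) :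
    traceNorm (M + N) ≤ traceNorm M + traceNorm N := by
  refine traceNorm_le fun K hK => ?_
  rw [mul_add, trace_add, Complex.add_re]
  exact add_le_add (hK.re_trace_mul_le_traceNorm M) (hK.re_trace_mul_le_traceNorm N)

lemma IsContraction.re_trace_mul_le {K Q : Matrix ι ι ℂ} (hK : IsContraction K)
    (hQ : Q.PosSemidef) : (K * Q).trace.re ≤ Q.trace.re := by
  have h := hK.two_mul_re_trace_le (CFC.sqrt Q) (CFC.sqrt Q) one_pos
  rw [show (CFC.sqrt Q)ᴴ = CFC.sqrt Q from (posSemidef_sqrt Q).1, sqrt_mul_sqrt hQ] at h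
  linarith

lemma traceNorm_smul_le (r : ℝ) {Q : Matrix ι ι ℂ} (hQ : Q.PosSemidef) :
    traceNorm ((r : ℂ) • Q) ≤ |r| * Q.trace.re := by
  refine traceNorm_le fun K hK => ?_
  rw [mul_smul_comm, trace_smul, smul_eq_mul, Complex.re_ofReal_mul]
  have h1 := hK.re_trace_mul_le hQ
  have h2 := hK.neg.re_trace_mul_le hQ
  rw [neg_mul, trace_neg, Complex.neg_re] at h2
  calc r * (K * Q).trace.re ≤ |r| * |(K * Q).trace.re| := by
        rw [← abs_mul]; exact le_abs_self _
    _ ≤ |r| * Q.trace.re := by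
        gcongr
        exact abs_le.2 ⟨by linarith, h1⟩

end TraceNorm

/-- The minimum over `t` of `t u + v / t`. -/
lemma le_two_mul_sqrt_of_forall_le {D u v : ℝ} (hu : 0 ≤ u) (hv : 0 ≤ v)
    (h : ∀ t : ℝ, 0 < t → D ≤ t * u + t⁻¹ * v) : D ≤ 2 * √(u * v) := by
  -- A positive `δ` added to both coefficients makes the minimizing `t` well defined.
  have key : ∀ δ : ℝ, 0 < δ → D ≤ 2 * √((u + δ) * (v + δ)) := by
    intro δ hδ
    have ha : 0 < √(u + δ) := Real.sqrt_pos.2 (by linarith)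
    have hb : 0 < √(v + δ) := Real.sqrt_pos.2 (by linarith)
    have ht : 0 < √(v + δ) / √(u + δ) := div_pos hb ha
    have h1 := h _ ht
    have h2 : √(v + δ) / √(u + δ) * (u + δ) + (√(v + δ) / √(u + δ))⁻¹ * (v + δ)
        = 2 * (√(u + δ) * √(v + δ)) := by
      have hua := Real.mul_self_sqrt (show 0 ≤ u + δ by linarith)
      have hvb := Real.mul_self_sqrt (show 0 ≤ v + δ by linarith)
      generalize √(u + δ) = a at *
      generalize √(v + δ) = b at *
      rw [← hua, ← hvb]
      field_simp
      ring
    rw [Real.sqrt_mul (by linarith), ← h2]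
    refine h1.trans ?_
    have := inv_pos.2 ht
    gcongr <;> linarith
  have hlim : Filter.Tendsto (fun δ : ℝ => 2 * √((u + δ) * (v + δ)))
      (nhdsWithin 0 (Set.Ioi 0)) (nhds (2 * √((u + 0) * (v + 0)))) :=
    (Continuous.tendsto (by fun_prop) 0).mono_left nhdsWithin_le_nhds
  simp only [add_zero] at hlim
  exact ge_of_tendsto hlim (Filter.eventually_of_mem self_mem_nhdsWithin key)

/-! ### Trace distance and purified distance -/

section FuchsVanDeGraaf

variable {ι : Type*} [Fintype ι] [DecidableEq ι]

/-- The Fuchs–van de Graaf inequality for sub-normalized states: the generalized trace distance is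
at most the purified distance. With a polar decomposition `C √ρ √τ = |√ρ √τ|` and the
projection `P = C Cᴴ`, `[√ρ, 0]` and `[√τ C, √τ (1 - P)]` are square roots of `ρ` and `τ` whose
Hilbert–Schmidt inner product is the fidelity. -/
lemma traceNorm_sub_add_le_purifiedDist {ρ τ : Matrix ι ι ℂ} (hρ : IsSubnormalized ρ)
    (hτ : IsSubnormalized τ) :
    traceNorm (ρ - τ) + |ρ.trace.re - τ.trace.re| ≤ 2 * purifiedDist ρ τ := by
  obtain ⟨hρ0, -, hρ1⟩ := hρ
  obtain ⟨hτ0, -, hτ1⟩ := hτ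
  obtain ⟨C, h1, -, h3⟩ := exists_polar (CFC.sqrt ρ * CFC.sqrt τ)
  have hF : (C * (CFC.sqrt ρ * CFC.sqrt τ)).trace.re
      = traceNorm (CFC.sqrt ρ * CFC.sqrt τ) := by rw [h1]; rfl
  have hF0 := traceNorm_nonneg (CFC.sqrt ρ * CFC.sqrt τ)
  have hgen : genFidelity ρ τ = traceNorm (CFC.sqrt ρ * CFC.sqrt τ)
      + √(1 - ρ.trace.re) * √(1 - τ.trace.re) := by
    rw [genFidelity, Real.sqrt_mul (by linarith)]
  have hAA := sqrt_mul_sqrt hρ0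
  have hBB := sqrt_mul_sqrt hτ0
  have hAh : (CFC.sqrt ρ)ᴴ = CFC.sqrt ρ := (posSemidef_sqrt ρ).1
  have hBh : (CFC.sqrt τ)ᴴ = CFC.sqrt τ := (posSemidef_sqrt τ).1
  set F := traceNorm (CFC.sqrt ρ * CFC.sqrt τ)
  set A := CFC.sqrt ρ
  set B := CFC.sqrt τ
  have ha := Real.mul_self_sqrt (show 0 ≤ 1 - ρ.trace.re by linarith)
  have hb := Real.mul_self_sqrt (show 0 ≤ 1 - τ.trace.re by linarith)
  have ha0 := Real.sqrt_nonneg (1 - ρ.trace.re)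
  have hb0 := Real.sqrt_nonneg (1 - τ.trace.re)
  set a := √(1 - ρ.trace.re)
  set b := √(1 - τ.trace.re)
  set N := B * C with hN
  set R := B * (1 - C * Cᴴ) with hR
  have hP : (1 - C * Cᴴ) * (1 - C * Cᴴ) = 1 - C * Cᴴ := by
    have : C * Cᴴ * (C * Cᴴ) = C * Cᴴ := by rw [← mul_assoc, h3]
    rw [sub_mul, mul_sub, one_mul, one_mul, mul_sub, mul_one, this]; abel
  have hNN : N * Nᴴ + R * Rᴴ = τ := by
    have e1 : R * Rᴴ = B * ((1 - C * Cᴴ) * (1 - C * Cᴴ)) * B := by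
      simp only [hR, conjTranspose_mul, conjTranspose_sub, conjTranspose_one,
        conjTranspose_conjTranspose, hBh, mul_assoc]
    have e2 : N * Nᴴ = B * (C * Cᴴ) * B := by
      simp only [hN, conjTranspose_mul, hBh, mul_assoc]
    rw [e1, e2, hP, ← hBB, ← add_mul, ← mul_add, add_sub_cancel, mul_one]
  have hAN : (A * Nᴴ).trace.re = F := by
    rw [← hF, ← re_trace_conjTranspose, conjTranspose_mul, conjTranspose_conjTranspose, hAh, hN,
      mul_assoc, trace_mul_comm, ← mul_assoc, trace_mul_comm]
  have hNA : (N * Aᴴ).trace.re = F := by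
    rw [← hAN, ← re_trace_conjTranspose, conjTranspose_mul, conjTranspose_conjTranspose]
  have hAA' : (A * Aᴴ).trace.re = ρ.trace.re := by rw [hAh, hAA]
  have hNR : (N * Nᴴ).trace.re + (R * Rᴴ).trace.re = τ.trace.re := by
    rw [← Complex.add_re, ← trace_add, hNN]
  have hx : ((A - N) * (A - N)ᴴ).trace.re = ρ.trace.re + (N * Nᴴ).trace.re - 2 * F := by
    simp only [conjTranspose_sub, sub_mul, mul_sub, trace_sub, Complex.sub_re, hAN, hNA, hAA']
    ring
  have hy : ((A + N) * (A + N)ᴴ).trace.re = ρ.trace.re + (N * Nᴴ).trace.re + 2 * F := by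
    simp only [conjTranspose_add, add_mul, mul_add, trace_add, Complex.add_re, hAN, hNA, hAA']
    ring
  have hx0 := re_trace_mul_conjTranspose_nonneg (A - N)
  have hR0 := re_trace_mul_conjTranspose_nonneg R
  have hu : 0 ≤ 1 - (F + a * b) := by nlinarith [sq_nonneg (a - b)]
  have hv : 0 ≤ 1 + (F + a * b) := by positivity
  have hP : purifiedDist ρ τ = √((1 - (F + a * b)) * (1 + (F + a * b))) := by
    rw [purifiedDist, hgen]; ring_nf
  rw [hP]
  refine le_two_mul_sqrt_of_forall_le hu hv fun t ht => ?_
  have ht' := inv_pos.2 ht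
  have htt : t * t⁻¹ = 1 := mul_inv_cancel₀ ht.ne'
  have hnorm : traceNorm (ρ - τ) ≤
      (t * (ρ.trace.re + τ.trace.re - 2 * F) + t⁻¹ * (ρ.trace.re + τ.trace.re + 2 * F)) / 2 := by
    refine traceNorm_le fun K hK => ?_
    have k1 := hK.two_mul_re_trace_le (A - N) (A + N) ht
    have k2 := hK.two_mul_re_trace_le (A + N) (A - N) ht'
    have k3 := hK.neg.two_mul_re_trace_le R R ht
    have e : K * ((A - N) * (A + N)ᴴ) + K * ((A + N) * (A - N)ᴴ) + -K * (R * Rᴴ)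
        + -K * (R * Rᴴ) = (2 : ℝ) • (K * (ρ - τ)) := by
      rw [← hNN, ← hAA, two_smul]
      simp only [conjTranspose_add, conjTranspose_sub, hAh, add_mul, sub_mul, mul_add, mul_sub,
        neg_mul]
      abel
    have e' := congrArg (fun M => M.trace.re) e
    simp only [trace_add, Complex.add_re, trace_smul, Complex.smul_re, smul_eq_mul] at e'
    rw [inv_inv] at k2
    rw [hx, hy] at k1 k2
    rw [← hNR]
    linarith
  have habs : |ρ.trace.re - τ.trace.re| ≤ (t * (a - b) ^ 2 + t⁻¹ * (a + b) ^ 2) / 2 := by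
    have e : ρ.trace.re - τ.trace.re = -((a - b) * (a + b)) := by linarith
    have h4 : t⁻¹ * (t * (a - b) - (a + b)) ^ 2
        = t * (a - b) ^ 2 + t⁻¹ * (a + b) ^ 2 - 2 * ((a - b) * (a + b)) := by
      field_simp; ring
    have h5 : t⁻¹ * (t * (a - b) + (a + b)) ^ 2
        = t * (a - b) ^ 2 + t⁻¹ * (a + b) ^ 2 + 2 * ((a - b) * (a + b)) := by
      field_simp; ring
    have h6 : 0 ≤ t⁻¹ * (t * (a - b) - (a + b)) ^ 2 := by positivity
    have h7 : 0 ≤ t⁻¹ * (t * (a - b) + (a + b)) ^ 2 := by positivity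
    rw [e, abs_neg, abs_le]
    constructor <;> linarith
  have e1 : ρ.trace.re = 1 - a * a := by linarith
  have e2 : τ.trace.re = 1 - b * b := by linarith
  calc traceNorm (ρ - τ) + |ρ.trace.re - τ.trace.re|
      ≤ (t * (ρ.trace.re + τ.trace.re - 2 * F) + t⁻¹ * (ρ.trace.re + τ.trace.re + 2 * F)) / 2
        + (t * (a - b) ^ 2 + t⁻¹ * (a + b) ^ 2) / 2 := add_le_add hnorm habs
    _ = t * (1 - (F + a * b)) + t⁻¹ * (1 + (F + a * b)) := by rw [e1, e2]; ring

end FuchsVanDeGraaf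

/-! ### Block-diagonal operators and measurement followed by hashing -/

section Blocks

variable {X S Z E : Type*}

/-- The `x`-th diagonal block of an operator on `X ⊗ E`, i.e. `⟨x| M |x⟩`. -/
def diagBlock (M : Matrix (X × E) (X × E) ℂ) (x : X) : Matrix E E ℂ :=
  M.submatrix (Prod.mk x) (Prod.mk x)

lemma posSemidef_diagBlock {M : Matrix (X × E) (X × E) ℂ} (hM : M.PosSemidef) (x : X) :
    (diagBlock M x).PosSemidef := hM.submatrix _

lemma trace_eq_sum_diagBlock [Fintype X] [Fintype E] (M : Matrix (X × E) (X × E) ℂ) :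
    M.trace = ∑ x, (diagBlock M x).trace := by
  simp [trace, Fintype.sum_prod_type, diagBlock]

lemma cqState_apply [Fintype X] [DecidableEq X] (ρ : X → Matrix E E ℂ) (a b : X × E) :
    cqState ρ a b = if a.1 = b.1 then ρ a.1 a.2 b.2 else 0 := by
  simp only [cqState, Matrix.sum_apply, kroneckerMap_apply, single_apply]
  split_ifs with h
  · rw [Finset.sum_eq_single a.1] <;> simp_all
  · refine Finset.sum_eq_zero fun x _ => ?_
    rw [if_neg (by rintro ⟨rfl, h'⟩; exact h h'), zero_mul]

lemma diagBlock_cqState [Fintype X] [DecidableEq X] (ρ : X → Matrix E E ℂ) (x : X) :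
    diagBlock (cqState ρ) x = ρ x := by
  ext; simp [diagBlock, cqState_apply]

lemma trace_cqState [Fintype X] [DecidableEq X] [Fintype E] (ρ : X → Matrix E E ℂ) :
    (cqState ρ).trace = ∑ x, (ρ x).trace := by
  simp [trace_eq_sum_diagBlock, diagBlock_cqState]

lemma cqState_conjTranspose_mul [Fintype X] [DecidableEq X] [Fintype E]
    (K L : X → Matrix E E ℂ) :
    (cqState K)ᴴ * cqState L = cqState fun x => (K x)ᴴ * L x := by
  ext ⟨x, i⟩ ⟨y, j⟩
  simp only [mul_apply, conjTranspose_apply, cqState_apply, Fintype.sum_prod_type]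
  rw [Finset.sum_eq_single x]
  · by_cases h : x = y <;> simp [h]
  · intro z _ hz; simp [hz]
  · simp

lemma posSemidef_cqState [Fintype X] [DecidableEq X] [Fintype E] {ρ : X → Matrix E E ℂ}
    (h : ∀ x, (ρ x).PosSemidef) : (cqState ρ).PosSemidef := by
  refine posSemidef_sum _ fun x _ => PosSemidef.kronecker ?_ (h x)
  rw [← diagonal_single]
  refine PosSemidef.diagonal fun i => ?_
  by_cases hi : i = x
  · subst hi; simp
  · simp [hi]

lemma trace_mul_cqState [Fintype X] [DecidableEq X] [Fintype E]
    (K : Matrix (X × E) (X × E) ℂ) (ρ : X → Matrix E E ℂ) :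
    (K * cqState ρ).trace = ∑ x, (diagBlock K x * ρ x).trace := by
  simp only [trace, diag_apply, mul_apply, cqState_apply, Fintype.sum_prod_type, diagBlock,
    submatrix_apply]
  refine Finset.sum_congr rfl fun x _ => Finset.sum_congr rfl fun i _ => ?_
  rw [Finset.sum_eq_single x] <;> simp +contextual

/-- The operator `∑_f ∑_z |S|⁻¹ |z⟩⟨z| ⊗ |f⟩⟨f| ⊗ N f z`, which is block diagonal with respect to
the output `z` and to the published, uniformly random seed `f`. -/
def seedAverage [Fintype S] [DecidableEq S] [Fintype Z] [DecidableEq Z]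
    (N : S → Z → Matrix E E ℂ) : Matrix (Z × (S × E)) (Z × (S × E)) ℂ :=
  cqState fun z => cqState fun f => (Fintype.card S : ℂ)⁻¹ • N f z

lemma seedAverage_apply [Fintype S] [DecidableEq S] [Fintype Z] [DecidableEq Z]
    (N : S → Z → Matrix E E ℂ) (a b : Z × (S × E)) :
    seedAverage N a b = if a.1 = b.1 then if a.2.1 = b.2.1 then
      (Fintype.card S : ℂ)⁻¹ * N a.2.1 a.1 a.2.2 b.2.2 else 0 else 0 := by
  simp [seedAverage, cqState_apply]

lemma hashedState_eq_seedAverage [Fintype S] [DecidableEq S] [Fintype X] [Fintype Z]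
    [DecidableEq Z] (F : S → X → Z) (ρ : X → Matrix E E ℂ) :
    hashedState F ρ = seedAverage fun f z => ∑ x with F f x = z, ρ x := by
  simp only [hashedState, seedAverage, cqState]
  rw [Finset.sum_comm]
  refine Finset.sum_congr rfl fun z _ => ?_
  ext a b
  simp only [kroneckerMap_apply, Matrix.sum_apply, Matrix.smul_apply, smul_eq_mul, Finset.mul_sum]
  exact Finset.sum_congr rfl fun f _ => by ring_nf

lemma sum_inv_card_mul [Fintype S] [Nonempty S] (r : ℝ) :
    ∑ _f : S, (Fintype.card S : ℝ)⁻¹ * r = r := by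
  have : (Fintype.card S : ℝ) ≠ 0 := by positivity
  simp [this]

lemma trace_hashedState [Fintype S] [DecidableEq S] [Nonempty S] [Fintype X] [Fintype Z]
    [DecidableEq Z] [Fintype E] (F : S → X → Z) (ρ : X → Matrix E E ℂ) :
    (hashedState F ρ).trace = ∑ x, (ρ x).trace := by
  have hS : (Fintype.card S : ℂ) ≠ 0 := by exact_mod_cast Fintype.card_ne_zero
  have h (f : S) : ∑ z, ∑ x with F f x = z, (ρ x).trace = ∑ x, (ρ x).trace :=
    Finset.sum_fiberwise _ _ _
  rw [hashedState_eq_seedAverage, seedAverage, trace_cqState]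
  simp only [trace_cqState, trace_smul, trace_sum, smul_eq_mul]
  rw [Finset.sum_comm]
  simp only [← Finset.mul_sum, h]
  simp [hS]

variable [Fintype X] [DecidableEq X] [Fintype E] [DecidableEq E]

lemma isContraction_cqState {K : X → Matrix E E ℂ} (hK : ∀ x, IsContraction (K x)) :
    IsContraction (cqState K) := by
  have h : 1 - (cqState K)ᴴ * cqState K = cqState fun x => 1 - (K x)ᴴ * K x := by
    rw [cqState_conjTranspose_mul]
    ext ⟨x, i⟩ ⟨y, j⟩
    simp only [Matrix.sub_apply, cqState_apply, one_apply, Prod.mk.injEq]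
    by_cases hxy : x = y <;> simp [hxy]
  rw [IsContraction, h]
  exact posSemidef_cqState hK

lemma IsContraction.diagBlock {K : Matrix (X × E) (X × E) ℂ} (hK : IsContraction K) (x : X) :
    IsContraction (diagBlock K x) := by
  -- Compression by the isometry `J = |x⟩ ⊗ 1`.
  set J : Matrix (X × E) E ℂ := (1 : Matrix (X × E) (X × E) ℂ).submatrix id (Prod.mk x) with hJ
  have hJJ : Jᴴ * J = 1 := by
    ext i j
    simp [hJ, mul_apply, one_apply]
  have hKJ : LeftoverHash.diagBlock K x = Jᴴ * K * J := by
    ext i j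
    simp [hJ, LeftoverHash.diagBlock, mul_apply, one_apply, apply_ite]
  have hproj : (1 - J * Jᴴ) * (1 - J * Jᴴ) = 1 - J * Jᴴ := by
    have : J * Jᴴ * (J * Jᴴ) = J * Jᴴ := by
      rw [Matrix.mul_assoc, ← Matrix.mul_assoc Jᴴ, hJJ, Matrix.one_mul]
    rw [sub_mul, mul_sub, one_mul, one_mul, mul_sub, mul_one, this]; abel
  have h : 1 - (Jᴴ * K * J)ᴴ * (Jᴴ * K * J) =
      Jᴴ * (1 - Kᴴ * K) * J + ((1 - J * Jᴴ) * (K * J))ᴴ * ((1 - J * Jᴴ) * (K * J)) := by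
    have e : ((1 - J * Jᴴ) * (K * J))ᴴ * ((1 - J * Jᴴ) * (K * J))
        = (K * J)ᴴ * (((1 - J * Jᴴ) * (1 - J * Jᴴ)) * (K * J)) := by
      simp only [conjTranspose_mul, conjTranspose_sub, conjTranspose_one,
        conjTranspose_conjTranspose, Matrix.mul_assoc]
    rw [e, hproj]
    simp only [conjTranspose_mul, conjTranspose_conjTranspose, Matrix.mul_sub, Matrix.sub_mul,
      Matrix.one_mul, Matrix.mul_one, hJJ, Matrix.mul_assoc]
    abel
  rw [IsContraction, hKJ, h]
  exact (hK.conjTranspose_mul_mul_same J).add (posSemidef_conjTranspose_mul_self _)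

variable [Fintype S] [DecidableEq S] [Fintype Z] [DecidableEq Z]

lemma trace_mul_seedAverage (K : Matrix (Z × (S × E)) (Z × (S × E)) ℂ)
    (N : S → Z → Matrix E E ℂ) :
    (K * seedAverage N).trace =
      ∑ f, (Fintype.card S : ℂ)⁻¹ * ∑ z, (diagBlock (diagBlock K z) f * N f z).trace := by
  simp only [seedAverage, trace_mul_cqState, mul_smul_comm, trace_smul, smul_eq_mul,
    Finset.mul_sum]
  exact Finset.sum_comm

lemma re_trace_mul_seedAverage (K : Matrix (Z × (S × E)) (Z × (S × E)) ℂ)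
    (N : S → Z → Matrix E E ℂ) :
    (K * seedAverage N).trace.re =
      ∑ f, (Fintype.card S : ℝ)⁻¹ * ∑ z, (diagBlock (diagBlock K z) f * N f z).trace.re := by
  have h : (Fintype.card S : ℂ)⁻¹ = (((Fintype.card S : ℝ)⁻¹ : ℝ) : ℂ) := by push_cast; rfl
  simp only [trace_mul_seedAverage, Complex.re_sum, h, Complex.re_ofReal_mul]

variable [Nonempty S]

/-- Measuring `X` and hashing the result does not increase the trace norm. -/
lemma traceNorm_hashedState_diagBlock_le (F : S → X → Z) (D : Matrix (X × E) (X × E) ℂ) :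
    traceNorm (hashedState F (diagBlock D)) ≤ traceNorm D := by
  refine traceNorm_le fun K hK => ?_
  rw [hashedState_eq_seedAverage, re_trace_mul_seedAverage,
    ← sum_inv_card_mul (S := S) (traceNorm D)]
  refine Finset.sum_le_sum fun f _ => mul_le_mul_of_nonneg_left ?_ (by positivity)
  have h := (isContraction_cqState fun x => (hK.diagBlock (F f x)).diagBlock f
    ).re_trace_mul_le_traceNorm D
  rw [trace_mul_comm, trace_mul_cqState, Complex.re_sum] at h
  refine le_of_eq_of_le ?_ h
  simp only [Matrix.mul_sum, trace_sum, Complex.re_sum]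
  rw [← Finset.sum_fiberwise Finset.univ (F f)]
  refine Finset.sum_congr rfl fun z _ => Finset.sum_congr rfl fun x hx => ?_
  rw [(Finset.mem_filter.1 hx).2, trace_mul_comm]

end Blocks

/-! ### Inequalities weighted by a positive definite operator -/

section WeightedYoung

variable {E : Type*} [Fintype E] [DecidableEq E]

/-- Young's inequality weighted by a positive definite `σ`: expand
`0 ≤ tr ((t K - Δ σ⁻¹) σ (t K - Δ σ⁻¹)ᴴ)`. -/
lemma IsContraction.two_mul_re_trace_le_of_posDef {K Δ σ : Matrix E E ℂ} (hK : IsContraction K)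
    (hΔ : Δᴴ = Δ) (hσ : σ.PosDef) {t : ℝ} (ht : 0 < t) :
    2 * (K * Δ).trace.re ≤ t * σ.trace.re + t⁻¹ * (Δ * σ⁻¹ * Δ).trace.re := by
  have hσh : σᴴ = σ := hσ.1
  have hdet : IsUnit σ.det := (Matrix.isUnit_iff_isUnit_det _).1 hσ.isUnit
  have h1 := hK.re_trace_conj_le hσ.posSemidef
  have h2 := re_trace_nonneg
    (hσ.posSemidef.mul_mul_conjTranspose_same ((t : ℂ) • K - Δ * σ⁻¹))
  have e1 : K * σ * (σ⁻¹ * Δ) = K * Δ := by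
    rw [mul_assoc, ← mul_assoc σ, mul_nonsing_inv _ hdet, one_mul]
  have e2 : Δ * σ⁻¹ * σ = Δ := by rw [mul_assoc, nonsing_inv_mul _ hdet, mul_one]
  have h3 : ((t : ℂ) • K - Δ * σ⁻¹) * σ * ((t : ℂ) • K - Δ * σ⁻¹)ᴴ =
      ((t ^ 2 : ℝ) : ℂ) • (K * σ * Kᴴ) - (t : ℂ) • (K * Δ) - (t : ℂ) • (K * Δ)ᴴ
        + Δ * σ⁻¹ * Δ := by
    simp only [conjTranspose_sub, conjTranspose_smul, conjTranspose_mul, sub_mul, mul_sub,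
      conjTranspose_nonsing_inv, hσh, hΔ, smul_mul_assoc, mul_smul_comm, Complex.star_def,
      Complex.conj_ofReal, Complex.ofReal_pow, e2, ← mul_assoc]
    rw [mul_assoc (K * σ), e1]
    module
  rw [h3] at h2
  simp only [trace_add, trace_sub, trace_smul, Complex.add_re, Complex.sub_re, smul_eq_mul,
    Complex.re_ofReal_mul, re_trace_conjTranspose] at h2
  have h4 : t * (2 * (K * Δ).trace.re) ≤
      t * (t * σ.trace.re + t⁻¹ * (Δ * σ⁻¹ * Δ).trace.re) := by
    rw [mul_add, ← mul_assoc t t⁻¹, mul_inv_cancel₀ ht.ne']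
    nlinarith [mul_le_mul_of_nonneg_left h1 (sq_nonneg t)]
  exact le_of_mul_le_mul_left h4 ht

/-- If `τ ≤ c σ` then `τ σ⁻¹ τ ≤ c τ`: multiplied by `c`, the difference of the two sides is
`(c - σ⁻¹ τ)ᴴ τ (c - σ⁻¹ τ) + (σ⁻¹ τ)ᴴ (c σ - τ) (σ⁻¹ τ)`. -/
lemma re_trace_mul_inv_mul_le {σ τ : Matrix E E ℂ} (hσ : σ.PosDef) (hτ : τ.PosSemidef) {c : ℝ}
    (hc : 0 < c) (h : ((c : ℂ) • σ - τ).PosSemidef) :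
    (τ * σ⁻¹ * τ).trace.re ≤ c * τ.trace.re := by
  have hσh : σᴴ = σ := hσ.1
  have hτh : τᴴ = τ := hτ.1
  have hdet : IsUnit σ.det := (Matrix.isUnit_iff_isUnit_det _).1 hσ.isUnit
  have h1 := re_trace_nonneg
    (hτ.conjTranspose_mul_mul_same ((c : ℂ) • (1 : Matrix E E ℂ) - σ⁻¹ * τ))
  have h2 := re_trace_nonneg (h.conjTranspose_mul_mul_same (σ⁻¹ * τ))
  have e : ((c : ℂ) • (1 : Matrix E E ℂ) - σ⁻¹ * τ)ᴴ * τ * ((c : ℂ) • (1 : Matrix E E ℂ) - σ⁻¹ * τ)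
      + (σ⁻¹ * τ)ᴴ * ((c : ℂ) • σ - τ) * (σ⁻¹ * τ)
      = (c : ℂ) • ((c : ℂ) • τ - τ * σ⁻¹ * τ) := by
    have e2 : τ * σ⁻¹ * σ = τ := by rw [mul_assoc, nonsing_inv_mul _ hdet, mul_one]
    simp only [conjTranspose_sub, conjTranspose_smul, conjTranspose_mul, sub_mul, mul_sub,
      conjTranspose_nonsing_inv, hσh, hτh, smul_mul_assoc, mul_smul_comm, Complex.star_def,
      Complex.conj_ofReal, e2, conjTranspose_one, one_mul, mul_one, ← mul_assoc]
    module
  have h3 := add_nonneg h1 h2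
  rw [← Complex.add_re, ← trace_add, e, trace_smul, smul_eq_mul, Complex.re_ofReal_mul, trace_sub,
    trace_smul, smul_eq_mul, Complex.sub_re, Complex.re_ofReal_mul] at h3
  have := nonneg_of_mul_nonneg_right h3 hc
  linarith

end WeightedYoung

/-! ### Hash families with constant collision probability -/

section Families

/-- All pairs of distinct inputs collide with the same probability `δ` over the choice of the
member, and `δ` does not exceed the collision probability `1 / |Z|` of uniform outputs. -/
def HasConstantCollisionProb {S X Z : Type*} [Fintype S] [Fintype Z] [DecidableEq Z]
    (F : S → X → Z) : Prop :=
  ∃ δ : ℝ, 0 ≤ δ ∧ δ ≤ (Fintype.card Z : ℝ)⁻¹ ∧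
    ∀ x y, x ≠ y → (Finset.card {f | F f x = F f y} : ℝ) = Fintype.card S * δ

lemma card_bits (n : ℕ) : Fintype.card (Bits n) = 2 ^ n := by
  simp [Bits]

lemma seedLength_bits {n : ℕ} {X Z : Type*} (F : Bits n → X → Z) : seedLength F = n := by
  rw [seedLength, card_bits]
  push_cast
  rw [Real.logb_pow, Real.logb_self_eq_one one_lt_two, mul_one]

lemma hasConstantCollisionProb_of_injective {S X Z : Type*} [Fintype S] [Fintype Z]
    [DecidableEq Z] {F : S → X → Z} (hF : ∀ f, Function.Injective (F f)) :
    HasConstantCollisionProb F :=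
  ⟨0, le_rfl, by positivity, fun x y h => by simp [(hF _).eq_iff, h]⟩

/-- The difference of the hashes of `x ≠ y` is the image of the seed `α` under a surjective linear
map, because `α ↦ (x - y) · α` is bijective. -/
lemma hasConstantCollisionProb_multHash {n ℓ : ℕ} (hℓ : ℓ ≤ n)
    (φ : GaloisField 2 n ≃ₗ[ZMod 2] Bits n) : HasConstantCollisionProb (multHash hℓ φ) := by
  refine ⟨(Fintype.card (Bits ℓ) : ℝ)⁻¹, by positivity, le_rfl, fun x y hxy => ?_⟩
  let a : GaloisField 2 n := φ.symm (x - y)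
  have ha : a ≠ 0 := by simpa [a, sub_eq_zero] using hxy
  let g : Bits n →ₗ[ZMod 2] Bits ℓ :=
    LinearMap.funLeft (ZMod 2) (ZMod 2) (Fin.castLE hℓ) ∘ₗ φ.toLinearMap ∘ₗ
      LinearMap.mulLeft (ZMod 2) a ∘ₗ φ.symm.toLinearMap
  have hg : Function.Surjective g := by
    have h1 : Function.Surjective (LinearMap.funLeft (ZMod 2) (ZMod 2) (Fin.castLE hℓ)) :=
      LinearMap.funLeft_surjective_of_injective _ _ _ (Fin.castLE_injective hℓ)
    have h2 : Function.Surjective (LinearMap.mulLeft (ZMod 2) a) := fun b =>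
      ⟨a⁻¹ * b, by simp [ha]⟩
    exact h1.comp (φ.surjective.comp (h2.comp φ.symm.surjective))
  have hcoll (α : Bits n) : multHash hℓ φ α x = multHash hℓ φ α y ↔ g α = 0 := by
    rw [← sub_eq_zero]
    have : multHash hℓ φ α x - multHash hℓ φ α y = g α := by
      funext i
      simp [multHash, g, a, LinearMap.funLeft_apply, sub_mul]
    rw [this]
  have hfib (z : Bits ℓ) : Finset.card {α | g α = z} = Finset.card {α | g α = 0} :=
    AddMonoidHom.card_fiber_eq_of_mem_range g.toAddMonoidHom (hg z) (hg 0)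
  have hsum := Finset.card_eq_sum_card_fiberwise (s := Finset.univ) (t := Finset.univ) (f := g)
    (fun _ _ => Finset.mem_coe.2 (Finset.mem_univ _))
  simp only [hfib, Finset.sum_const, smul_eq_mul, Finset.card_univ] at hsum
  simp only [hcoll]
  have hne : (Fintype.card (Bits ℓ) : ℝ) ≠ 0 := by positivity
  rw [hsum]
  push_cast
  field_simp

lemma exists_hasConstantCollisionProb (n ℓ : ℕ) :
    ∃ F : Bits n → Bits n → Bits ℓ, HasConstantCollisionProb F := by
  rcases le_or_gt n ℓ with h | h
  · refine ⟨fun _ x i => if hi : (i : ℕ) < n then x ⟨i, hi⟩ else 0,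
      hasConstantCollisionProb_of_injective fun _ x y hxy => ?_⟩
    funext i
    simpa using congrFun hxy (Fin.castLE h i)
  · have hn : n ≠ 0 := by omega
    have hfr : Module.finrank (ZMod 2) (GaloisField 2 n) =
        Module.finrank (ZMod 2) (Bits n) := by
      rw [GaloisField.finrank 2 hn]; simp
    exact ⟨_, hasConstantCollisionProb_multHash h.le (LinearEquiv.ofFinrankEq _ _ hfr)⟩

end Families

/-! ### The leftover hash lemma -/

section Collision

lemma sum_deviation_coeff_mul {S X Z : Type*} [Fintype Z] [DecidableEq Z] [Nonempty Z]
    (F : S → X → Z) (f : S) (x y : X) :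
    ∑ z, ((if F f x = z then 1 else 0) - (Fintype.card Z : ℝ)⁻¹) *
      ((if F f y = z then 1 else 0) - (Fintype.card Z : ℝ)⁻¹) =
    (if F f x = F f y then 1 else 0) - (Fintype.card Z : ℝ)⁻¹ := by
  have hZ : (Fintype.card Z : ℝ) ≠ 0 := by positivity
  simp only [sub_mul, mul_sub, Finset.sum_sub_distrib, ite_mul, mul_ite, one_mul, mul_one, zero_mul,
    mul_zero, Finset.sum_ite_eq, Finset.mem_univ, if_true, Finset.sum_const, Finset.card_univ,
    nsmul_eq_mul]
  rw [mul_inv_cancel_left₀ hZ, sub_self, sub_zero]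

variable {E : Type*} [Fintype E] [DecidableEq E]
variable {S X Z : Type*} [Fintype S] [Fintype X] [DecidableEq X] [Fintype Z] [DecidableEq Z]

/-- The deviation of the unnormalized state on `E` for hash value `z` from its average. -/
def deviation (F : S → X → Z) (τ : X → Matrix E E ℂ) (f : S) (z : Z) : Matrix E E ℂ :=
  ∑ x, (((if F f x = z then 1 else 0) - (Fintype.card Z : ℝ)⁻¹ : ℝ) : ℂ) • τ x

/-- Averaged over the seed, the quadratic form `Δ ↦ tr (Δ σ⁻¹ Δ)` of the deviation is at most its
sum over the states `τ x`: with collision probability `δ`, the average is exactly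
`(1 - δ) ∑ₓ tr (τₓ σ⁻¹ τₓ) + (δ - 1 / |Z|) tr (τ_E σ⁻¹ τ_E)`, where `τ_E = ∑ₓ τₓ`. -/
lemma sum_re_trace_deviation_le [Nonempty S] [Nonempty Z] {F : S → X → Z}
    (hF : HasConstantCollisionProb F) {τ : X → Matrix E E ℂ} (hτ : ∀ x, (τ x).PosSemidef)
    {σ : Matrix E E ℂ} (hσ : σ.PosDef) :
    ∑ f, (Fintype.card S : ℝ)⁻¹ *
        ∑ z, (deviation F τ f z * σ⁻¹ * deviation F τ f z).trace.re ≤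
      ∑ x, (τ x * σ⁻¹ * τ x).trace.re := by
  obtain ⟨δ, hδ0, hδ, hcoll⟩ := hF
  have hS : (Fintype.card S : ℝ) ≠ 0 := by positivity
  set q : X → X → ℝ := fun x y => (τ x * σ⁻¹ * τ y).trace.re with hq
  have hquad (a : X → ℝ) : ((∑ x, (a x : ℂ) • τ x) * σ⁻¹ * ∑ x, (a x : ℂ) • τ x).trace.re
      = ∑ x, ∑ y, a x * a y * q x y := by
    simp only [Matrix.sum_mul, Matrix.mul_sum, smul_mul_assoc, mul_smul_comm, trace_sum,
      trace_smul, Complex.re_sum, smul_eq_mul, Complex.re_ofReal_mul, hq, mul_assoc]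
    rw [Finset.sum_comm]
    refine Finset.sum_congr rfl fun x _ => ?_
    rw [Finset.mul_sum]
    exact Finset.sum_congr rfl fun y _ => mul_left_comm _ _ _
  have hpos {M : Matrix E E ℂ} (hM : M.PosSemidef) : 0 ≤ (M * σ⁻¹ * M).trace.re := by
    have h := re_trace_nonneg (hσ.inv.posSemidef.mul_mul_conjTranspose_same M)
    rwa [show Mᴴ = M from hM.1] at h
  have hprob (x y : X) : ∑ f, (Fintype.card S : ℝ)⁻¹ *
      ((if F f x = F f y then 1 else 0) - (Fintype.card Z : ℝ)⁻¹) =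
      (if x = y then 1 - δ else 0) + (δ - (Fintype.card Z : ℝ)⁻¹) := by
    simp only [mul_sub, Finset.sum_sub_distrib, sum_inv_card_mul]
    rw [← Finset.mul_sum, Finset.sum_boole]
    by_cases hxy : x = y
    · subst hxy; simp [hS]
    · rw [hcoll x y hxy, inv_mul_cancel_left₀ hS, if_neg hxy, zero_add]
  have htot : ∑ f, (Fintype.card S : ℝ)⁻¹ *
        ∑ z, (deviation F τ f z * σ⁻¹ * deviation F τ f z).trace.re =
      (1 - δ) * ∑ x, q x x + (δ - (Fintype.card Z : ℝ)⁻¹) * ∑ x, ∑ y, q x y := by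
    have h1 (f : S) : ∑ z, (deviation F τ f z * σ⁻¹ * deviation F τ f z).trace.re =
        ∑ x, ∑ y, ((if F f x = F f y then 1 else 0) - (Fintype.card Z : ℝ)⁻¹) * q x y := by
      simp only [deviation, hquad]
      rw [Finset.sum_comm]
      refine Finset.sum_congr rfl fun x _ => ?_
      rw [Finset.sum_comm]
      refine Finset.sum_congr rfl fun y _ => ?_
      rw [← Finset.sum_mul, sum_deviation_coeff_mul]
    have h2 : ∑ f, (Fintype.card S : ℝ)⁻¹ *
        ∑ x, ∑ y, ((if F f x = F f y then 1 else 0) - (Fintype.card Z : ℝ)⁻¹) * q x y =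
        ∑ x, ∑ y, ((if x = y then 1 - δ else 0) + (δ - (Fintype.card Z : ℝ)⁻¹)) * q x y := by
      simp only [Finset.mul_sum]
      rw [Finset.sum_comm]
      refine Finset.sum_congr rfl fun x _ => ?_
      rw [Finset.sum_comm]
      refine Finset.sum_congr rfl fun y _ => ?_
      rw [← hprob, Finset.sum_mul]
      exact Finset.sum_congr rfl fun f _ => (mul_assoc _ _ _).symm
    simp only [h1, h2, add_mul, Finset.sum_add_distrib, ite_mul, zero_mul, Finset.sum_ite_eq,
      Finset.mem_univ, if_true, ← Finset.mul_sum]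
  have hall : 0 ≤ ∑ x, ∑ y, q x y := by
    have h := hpos (posSemidef_sum Finset.univ fun x _ => hτ x)
    have h' := hquad fun _ => 1
    simp only [Complex.ofReal_one, one_smul, one_mul] at h'
    rwa [h'] at h
  have hdiag : 0 ≤ ∑ x, q x x := Finset.sum_nonneg fun x _ => hpos (hτ x)
  rw [htot]
  nlinarith [mul_nonneg hδ0 hdiag, mul_nonneg (sub_nonneg.2 hδ) hall]

variable [DecidableEq S]

/-- The leftover hash lemma in trace norm, for a positive definite `σ`. -/
lemma traceNorm_seedAverage_deviation_le_of_posDef [Nonempty S] [Nonempty Z] {F : S → X → Z}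
    (hF : HasConstantCollisionProb F) {τ : X → Matrix E E ℂ} (hτ : ∀ x, (τ x).PosSemidef)
    {σ : Matrix E E ℂ} (hσ : σ.PosDef) {c : ℝ} (hc : 0 < c)
    (h : ∀ x, ((c : ℂ) • σ - τ x).PosSemidef) :
    traceNorm (seedAverage (deviation F τ)) ≤
      √(Fintype.card Z * σ.trace.re * (c * ∑ x, (τ x).trace.re)) := by
  have hu : 0 ≤ Fintype.card Z * σ.trace.re :=
    mul_nonneg (by positivity) (re_trace_nonneg hσ.posSemidef)
  have hv : 0 ≤ c * ∑ x, (τ x).trace.re :=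
    mul_nonneg hc.le (Finset.sum_nonneg fun x _ => re_trace_nonneg (hτ x))
  have hΔ (f : S) (z : Z) : (deviation F τ f z)ᴴ = deviation F τ f z := by
    simp only [deviation, conjTranspose_sum, conjTranspose_smul, Complex.star_def,
      Complex.conj_ofReal, fun x => show (τ x)ᴴ = τ x from (hτ x).1]
  suffices 2 * traceNorm (seedAverage (deviation F τ)) ≤
      2 * √(Fintype.card Z * σ.trace.re * (c * ∑ x, (τ x).trace.re)) by linarith
  refine le_two_mul_sqrt_of_forall_le hu hv fun t ht => ?_
  obtain ⟨K, hK, hKeq⟩ := exists_isContraction_re_trace_eq (seedAverage (deviation F τ))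
  rw [← hKeq, re_trace_mul_seedAverage, Finset.mul_sum]
  calc ∑ f, 2 * ((Fintype.card S : ℝ)⁻¹ *
          ∑ z, (diagBlock (diagBlock K z) f * deviation F τ f z).trace.re)
      ≤ ∑ f, (Fintype.card S : ℝ)⁻¹ * (t * (Fintype.card Z * σ.trace.re) +
          t⁻¹ * ∑ z, (deviation F τ f z * σ⁻¹ * deviation F τ f z).trace.re) := by
        refine Finset.sum_le_sum fun f _ => ?_
        rw [mul_left_comm]
        refine mul_le_mul_of_nonneg_left ?_ (by positivity)
        calc 2 * ∑ z, (diagBlock (diagBlock K z) f * deviation F τ f z).trace.re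
            ≤ ∑ z, (t * σ.trace.re +
                t⁻¹ * (deviation F τ f z * σ⁻¹ * deviation F τ f z).trace.re) := by
              rw [Finset.mul_sum]
              exact Finset.sum_le_sum fun z _ => ((hK.diagBlock z).diagBlock f
                ).two_mul_re_trace_le_of_posDef (hΔ f z) hσ ht
          _ = _ := by
              rw [Finset.sum_add_distrib, Finset.sum_const, Finset.card_univ, nsmul_eq_mul,
                mul_left_comm, Finset.mul_sum]
    _ = t * (Fintype.card Z * σ.trace.re) + t⁻¹ * ∑ f, (Fintype.card S : ℝ)⁻¹ *
          ∑ z, (deviation F τ f z * σ⁻¹ * deviation F τ f z).trace.re := by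
        simp only [mul_add, Finset.sum_add_distrib, sum_inv_card_mul]
        rw [Finset.mul_sum]
        exact congrArg _ (Finset.sum_congr rfl fun f _ => mul_left_comm _ _ _)
    _ ≤ t * (Fintype.card Z * σ.trace.re) + t⁻¹ * (c * ∑ x, (τ x).trace.re) := by
        have := inv_pos.2 ht
        gcongr
        refine (sum_re_trace_deviation_le hF hτ hσ).trans ?_
        rw [Finset.mul_sum]
        exact Finset.sum_le_sum fun x _ => re_trace_mul_inv_mul_le hσ (hτ x) hc (h x)

lemma traceNorm_seedAverage_deviation_le [Nonempty S] [Nonempty Z] {F : S → X → Z}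
    (hF : HasConstantCollisionProb F) {τ : X → Matrix E E ℂ} (hτ : ∀ x, (τ x).PosSemidef)
    {σ : Matrix E E ℂ} (hσ : σ.PosSemidef) {c : ℝ} (hc : 0 < c)
    (h : ∀ x, ((c : ℂ) • σ - τ x).PosSemidef) :
    traceNorm (seedAverage (deviation F τ)) ≤
      √(Fintype.card Z * σ.trace.re * (c * ∑ x, (τ x).trace.re)) := by
  -- Approximate `σ` by the positive definite `σ + η`.
  have key : ∀ η : ℝ, 0 < η → traceNorm (seedAverage (deviation F τ)) ≤
      √(Fintype.card Z * (σ.trace.re + η * Fintype.card E) * (c * ∑ x, (τ x).trace.re)) := by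
    intro η hη
    have h1 : ((η : ℂ) • (1 : Matrix E E ℂ)).PosDef :=
      PosDef.one.smul (by exact_mod_cast hη)
    have h2 := traceNorm_seedAverage_deviation_le_of_posDef hF hτ (h1.posSemidef_add hσ) hc
      fun x => by
        have h3 : (c : ℂ) • (σ + (η : ℂ) • (1 : Matrix E E ℂ)) - τ x =
            ((c : ℂ) • σ - τ x) + (c : ℂ) • (η : ℂ) • (1 : Matrix E E ℂ) := by
          rw [smul_add]; abel
        rw [h3]
        exact (h x).add (h1.posSemidef.smul (by exact_mod_cast hc.le))
    simpa [trace_add, trace_smul] using h2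
  have hlim : Filter.Tendsto (fun η : ℝ => √(Fintype.card Z * (σ.trace.re + η * Fintype.card E) *
      (c * ∑ x, (τ x).trace.re))) (nhdsWithin 0 (Set.Ioi 0))
      (nhds (√(Fintype.card Z * (σ.trace.re + 0 * Fintype.card E) *
        (c * ∑ x, (τ x).trace.re)))) :=
    (Continuous.tendsto (by fun_prop) 0).mono_left nhdsWithin_le_nhds
  rw [zero_mul, add_zero] at hlim
  exact ge_of_tendsto hlim (Filter.eventually_of_mem self_mem_nhdsWithin key)

end Collision

/-! ### The error bound for smooth min-entropy -/

section ErrorBound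

variable {S X Z E : Type*} [Fintype S] [DecidableEq S] [Fintype X] [DecidableEq X] [Fintype Z]
  [DecidableEq Z] [Fintype E] [DecidableEq E]

/-- Each operator `σ` of the right trace bounds the distance from uniform, which is an infimum. -/
lemma distFromUniform_le {A B : Type*} [Fintype A] [DecidableEq A] [Fintype B] [DecidableEq B]
    (ρ : Matrix (A × B) (A × B) ℂ) {σ : Matrix B B ℂ} (hσ : σ.PosSemidef)
    (htr : σ.trace = ρ.trace) : distFromUniform ρ ≤
      1 / 2 * traceNorm (ρ - ((Fintype.card A : ℂ)⁻¹ • (1 : Matrix A A ℂ)) ⊗ₖ σ) := by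
  refine csInf_le ⟨0, ?_⟩ ⟨σ, ⟨hσ, htr⟩, rfl⟩
  rintro _ ⟨σ', -, rfl⟩
  exact mul_nonneg (by norm_num) (traceNorm_nonneg _)

/-- The extraction error for `ρ` in terms of any state `τ`, which need not be classical on `X`. The
uniform reference state for `ρ` is that of the measured `τ`, rescaled to the trace of `ρ`; the
rescaling costs `|tr ρ - tr τ|`. -/
lemma two_mul_extractionError_le [Nonempty S] [Nonempty Z] (F : S → X → Z)
    {ρ : X → Matrix E E ℂ} (hρ : IsSubnormalized (cqState ρ))
    {τ : Matrix (X × E) (X × E) ℂ} (hτ : IsSubnormalized τ) :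
    2 * extractionError F ρ ≤ traceNorm (cqState ρ - τ) +
      |(cqState ρ).trace.re - τ.trace.re| +
      traceNorm (seedAverage (deviation F (diagBlock τ))) := by
  obtain ⟨hρ0, -, -⟩ := hρ
  obtain ⟨hτ0, hτpos, -⟩ := hτ
  have hS : (Fintype.card S : ℂ) ≠ 0 := by exact_mod_cast Fintype.card_ne_zero
  have hZ : (Fintype.card Z : ℂ) ≠ 0 := by exact_mod_cast Fintype.card_ne_zero
  have hreal {ι : Type _} [Fintype ι] {M : Matrix ι ι ℂ} (hM : M.PosSemidef) :
      M.trace = (M.trace.re : ℂ) := Complex.ext rfl (Complex.le_def.1 hM.trace_nonneg).2.symm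
  set ω : Matrix Z Z ℂ := (Fintype.card Z : ℂ)⁻¹ • (1 : Matrix Z Z ℂ) with hω
  have hω0 : ω.PosSemidef := PosSemidef.one.smul (by positivity)
  set σ : Matrix (S × E) (S × E) ℂ :=
    ((Fintype.card S : ℂ)⁻¹ • (1 : Matrix S S ℂ)) ⊗ₖ (∑ x, diagBlock τ x) with hσ
  have hσ0 : σ.PosSemidef := PosSemidef.kronecker (PosSemidef.one.smul (by positivity))
    (posSemidef_sum _ fun x _ => posSemidef_diagBlock hτ0 x)
  have hσtr : σ.trace = τ.trace := by
    rw [hσ, trace_kronecker, trace_smul, trace_one, smul_eq_mul, inv_mul_cancel₀ hS, one_mul,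
      trace_sum, trace_eq_sum_diagBlock]
  have hωσtr : (ω ⊗ₖ σ).trace = τ.trace := by
    rw [trace_kronecker, hω, trace_smul, trace_one, smul_eq_mul, inv_mul_cancel₀ hZ, one_mul, hσtr]
  have hωσ : ω ⊗ₖ σ = seedAverage fun _ _ => (Fintype.card Z : ℂ)⁻¹ • ∑ x, diagBlock τ x := by
    ext ⟨z, f, e⟩ ⟨z', f', e'⟩
    simp only [seedAverage_apply, hω, hσ, kroneckerMap_apply, Matrix.smul_apply, one_apply,
      smul_eq_mul]
    split_ifs <;> ring
  set r : ℝ := (cqState ρ).trace.re / τ.trace.re with hr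
  have hr0 : 0 ≤ r := div_nonneg (re_trace_nonneg hρ0) hτpos.le
  have hrσtr : ((r : ℂ) • σ).trace = (hashedState F ρ).trace := by
    rw [trace_smul, hσtr, hreal hτ0, trace_hashedState, ← trace_cqState, hreal hρ0, smul_eq_mul,
      ← Complex.ofReal_mul, hr, div_mul_cancel₀ _ hτpos.ne']
  have hrσ0 : ((r : ℂ) • σ).PosSemidef := hσ0.smul (by exact_mod_cast hr0)
  have hdecomp : hashedState F ρ - ω ⊗ₖ ((r : ℂ) • σ) =
      hashedState F (diagBlock (cqState ρ - τ)) + seedAverage (deviation F (diagBlock τ)) +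
        ((1 - r : ℝ) : ℂ) • (ω ⊗ₖ σ) := by
    have hdev (f : S) (z : Z) : deviation F (diagBlock τ) f z =
        ∑ x with F f x = z, diagBlock τ x - (Fintype.card Z : ℂ)⁻¹ • ∑ x, diagBlock τ x := by
      simp only [deviation, Complex.ofReal_sub, sub_smul, Finset.sum_sub_distrib, Finset.smul_sum,
        Finset.sum_filter]
      push_cast
      simp
    have hblock (x : X) : diagBlock (cqState ρ - τ) x = ρ x - diagBlock τ x := by
      rw [← diagBlock_cqState ρ x]; rfl
    rw [kronecker_smul, hωσ, hashedState_eq_seedAverage, hashedState_eq_seedAverage]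
    ext ⟨z, f, e⟩ ⟨z', f', e'⟩
    simp only [Matrix.add_apply, Matrix.sub_apply, Matrix.smul_apply, seedAverage_apply, hdev,
      hblock, Finset.sum_sub_distrib, smul_eq_mul]
    push_cast
    split_ifs <;> ring
  have h1 := distFromUniform_le (hashedState F ρ) hrσ0 hrσtr
  rw [← hω, hdecomp] at h1
  have h2 := traceNorm_hashedState_diagBlock_le F (cqState ρ - τ)
  have h3 := traceNorm_smul_le (1 - r) (hω0.kronecker hσ0)
  rw [hωσtr, ← abs_of_pos hτpos, ← abs_mul, sub_mul, one_mul, hr,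
    div_mul_cancel₀ _ hτpos.ne', abs_sub_comm] at h3
  have h4 := traceNorm_add_le (hashedState F (diagBlock (cqState ρ - τ)) +
    seedAverage (deviation F (diagBlock τ))) (((1 - r : ℝ) : ℂ) • (ω ⊗ₖ σ))
  have h5 := traceNorm_add_le (hashedState F (diagBlock (cqState ρ - τ)))
    (seedAverage (deviation F (diagBlock τ)))
  rw [extractionError]
  linarith

lemma extractionError_le [Nonempty S] [Nonempty Z] {F : S → X → Z}
    (hF : HasConstantCollisionProb F) {ρ : X → Matrix E E ℂ}
    (hρ : IsSubnormalized (cqState ρ)) {ε : ℝ} {τ : Matrix (X × E) (X × E) ℂ}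
    (hτ : τ ∈ epsBall ε (cqState ρ)) {σ : Matrix E E ℂ} (hσ : IsNormalized σ) {c : ℝ} (hc : 0 < c)
    (h : τ ≤ c • ((1 : Matrix X X ℂ) ⊗ₖ σ)) :
    extractionError F ρ ≤ ε + 1 / 2 * √(Fintype.card Z * c) := by
  obtain ⟨hτs, hdist⟩ := hτ
  have hblock (x : X) : ((c : ℂ) • σ - diagBlock τ x).PosSemidef := by
    convert posSemidef_diagBlock (Matrix.le_iff.1 h) x using 1
    ext i j
    simp [diagBlock]
  have h1 := traceNorm_seedAverage_deviation_le hF (posSemidef_diagBlock hτs.1) hσ.1 hc hblock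
  have h2 : (Fintype.card Z : ℝ) * σ.trace.re * (c * ∑ x, (diagBlock τ x).trace.re) ≤
      Fintype.card Z * c := by
    rw [hσ.2, ← Complex.re_sum, ← trace_eq_sum_diagBlock, Complex.one_re, mul_one, ← mul_assoc]
    exact mul_le_of_le_one_right (by positivity) hτs.2.2
  have h3 := two_mul_extractionError_le F hρ hτs
  have h4 := traceNorm_sub_add_le_purifiedDist hρ hτs
  have h5 := Real.sqrt_le_sqrt h2
  linarith

end ErrorBound

lemma twoPow_coe (x : ℝ) : twoPow (x : EReal) = ENNReal.ofReal (2 ^ x) := by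
  rw [twoPow, if_neg (EReal.coe_ne_bot x), if_neg (EReal.coe_ne_top x), EReal.toReal_coe,
    ← ENNReal.ofReal_rpow_of_pos two_pos, ENNReal.ofReal_ofNat]

lemma satisfiesErrorBound_of_hasConstantCollisionProb {S X : Type} {ℓ : ℕ} [Fintype S]
    [DecidableEq S] [Nonempty S] [Fintype X] [DecidableEq X] {F : S → X → Bits ℓ}
    (hF : HasConstantCollisionProb F) : SatisfiesErrorBound.{u} F := by
  intro E _ _ ρ hρ ε hε
  set e := extractionError F ρ
  rcases le_or_gt e ε with hle | hlt
  · exact (ENNReal.ofReal_le_ofReal hle).trans le_self_add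
  -- The bound at `lam` is solved for `lam`, and so passes to the supremum of all admissible `lam`.
  set L : ℝ := ℓ - 2 * Real.logb 2 (2 * (e - ε)) with hL
  have hpos : 0 < 2 * (e - ε) := by linarith
  have hsup : smoothMinEntropy ε (cqState ρ) ≤ (L : EReal) := by
    refine iSup₂_le fun τ hτ => iSup₂_le fun σ hσ => iSup₂_le fun lam hlam => ?_
    have h := extractionError_le hF hρ hτ hσ (Real.rpow_pos_of_pos two_pos (-lam)) hlam
    have h1 : 2 * (e - ε) ≤ √((2 : ℝ) ^ ((ℓ : ℝ) - lam)) := by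
      rw [card_bits, Nat.cast_pow, Nat.cast_ofNat, ← Real.rpow_natCast, ← Real.rpow_add two_pos,
        ← sub_eq_add_neg] at h
      linarith
    rw [Real.sqrt_eq_rpow, ← Real.rpow_mul two_pos.le,
      ← Real.logb_le_iff_le_rpow one_lt_two hpos] at h1
    exact EReal.coe_le_coe_iff.2 (by linarith)
  generalize smoothMinEntropy ε (cqState ρ) = H at hsup
  induction H with
  | bot => simp [twoPow, EReal.sub_bot (EReal.natCast_ne_bot ℓ)]
  | top => exact absurd hsup (by simp)
  | coe lam =>
    have hlam : lam ≤ L := EReal.coe_le_coe_iff.1 hsup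
    have h1 : 2 * (e - ε) ≤ (2 : ℝ) ^ (((ℓ : ℝ) - lam) * (1 / 2)) := by
      rw [← Real.logb_le_iff_le_rpow one_lt_two hpos]
      linarith
    have h2 : ((ℓ : EReal) - (lam : EReal)) = (((ℓ : ℝ) - lam : ℝ) : EReal) := by
      rw [EReal.coe_sub]; rfl
    have h3 : (1 / 2 : ℝ≥0∞) = ENNReal.ofReal (1 / 2) := by
      rw [ENNReal.ofReal_div_of_pos two_pos]; simp
    rw [h2, twoPow_coe, ENNReal.ofReal_rpow_of_pos (Real.rpow_pos_of_pos two_pos _),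
      ← Real.rpow_mul two_pos.le, h3, ← ENNReal.ofReal_mul (by norm_num),
      ← ENNReal.ofReal_add hε (by positivity)]
    exact ENNReal.ofReal_le_ofReal (by linarith)

end

end LeftoverHash

/-- For all `n` and `ℓ` there is a family of hash functions from `n`-bit to `ℓ`-bit strings, chosen
before the state and `ε`, with seed length `n` and the stated error bound; for `n ≥ 1` and `ℓ ≤ n`
multiplication in `GF(2^n)` truncated to `ℓ` bits is such a family. -/
theorem theorem3 (n ℓ : ℕ) :
    (∃ F : LeftoverHash.Bits n → LeftoverHash.Bits n → LeftoverHash.Bits ℓ,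
      LeftoverHash.seedLength F = n ∧ LeftoverHash.SatisfiesErrorBound.{u} F) ∧
    (0 < n → ∀ (hℓ : ℓ ≤ n)
      (φ : GaloisField 2 n ≃ₗ[ZMod 2] LeftoverHash.Bits n),
      LeftoverHash.seedLength (LeftoverHash.multHash hℓ φ) = n ∧
        LeftoverHash.SatisfiesErrorBound.{u} (LeftoverHash.multHash hℓ φ)) := by
  obtain ⟨F, hF⟩ := LeftoverHash.exists_hasConstantCollisionProb n ℓ
  exact ⟨⟨F, LeftoverHash.seedLength_bits F,
      LeftoverHash.satisfiesErrorBound_of_hasConstantCollisionProb hF⟩,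
    fun _ hℓ φ => ⟨LeftoverHash.seedLength_bits _,
      LeftoverHash.satisfiesErrorBound_of_hasConstantCollisionProb
        (LeftoverHash.hasConstantCollisionProb_multHash hℓ φ)⟩⟩
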